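/- Consider a linear system with one control input $u$, one disturbance input $w$ and one output $z$, $$\dot x = Ax + B_1 w + B_2 u,\qquad z = C_1 x,$$ with $A\in\mathbb{R}^{n\times n}$, $B_1,B_2\in\mathbb{R}^{n\times 1}$, $C_1\in\mathbb{R}^{1\times n}$, $n\ge 2$, such that $C_1B_2\neq 0$ and $R = C_1B_1+B_1^TC_1^T>0$. Put $Q = I-B_2(C_1B_2)^{-1}C_1$, $A_q = QA$ and, for $\varepsilon\ge 0$, $A_r(\varepsilon)=Q(A+\varepsilon I)$. By an ordered Schur decomposition of $A_r(\varepsilon)$ we mean an orthogonal matrix $U$ with $$U^TA_r(\varepsilon)U=\begin{bmatrix}\tilde A_{11}&\tilde A_{12}\\0&\tilde A_{22}\end{bmatrix},\qquad U^TB_1=\begin{bmatrix}\tilde B_{11}\\ \tilde B_{22}\end{bmatrix},\qquad U^T\big(B_2(C_1B_2)^{-1}-B_1R^{-1}\big)=\begin{bmatrix}\tilde C_{11}\\ \tilde C_{22}\end{bmatrix},$$ where all eigenvalues of $\tilde A_{11}$ have real part $\le 0$ and all eigenvalues of $\tilde A_{22}$ have real part $>0$. Given such a decomposition, the Lyapunov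 conditions on symmetric matrices $T\ge 0$, $S\ge 0$ are $$-\tilde A_{22}T-T\tilde A_{22}^T+\tilde C_{22}R\tilde C_{22}^T=0,\qquad -\tilde A_{22}S-S\tilde A_{22}^T+\tilde B_{22}R^{-1}\tilde B_{22}^T=0,\qquad T-S>0,$$ and the associated state feedback matrix is $$K=(C_1B_2)^{-1}\big(B_1^TP-C_1A-\varepsilon C_1-R(B_2^TC_1^T)^{-1}B_2^TP\big),\qquad P=U\begin{bmatrix}0&0\\0&(T-S)^{-1}\end{bmatrix}U^T.$$ Assume that the Lyapunov conditions can be satisfied for some ordered Schur decomposition of $A_r(\varepsilon_0)$ for some $\varepsilon_0\ge 0$ (for instance $\varepsilon_0=0$), and that $(A,B_2)$ is controllable. Assume also that $A_q$ has $n$ distinct eigenvalues $\lambda_1,\dots,\lambda_n$, ordered so that $\operatorname{Re}\lambda_1\le\dots\le\operatorname{Re}\lambda_n$, with $\operatorname{Re}\lambda_i<0$ for $i\le n-2$, $\lambda_{n-1}=0$, and $\lambda_n$ real and positive. Let $\gamma=-\operatorname{Re}\lambda_{n-2}$ (and $\gamma=\infty$ if $n=2$). Then for every $\varepsilon$ with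 $0<\varepsilon<\gamma$: $A_r(\varepsilon)$ has an ordered Schur decomposition; for every such decomposition there are $T\ge0$ and $S\ge0$ satisfying the Lyapunov conditions; and for all such $T$, $S$, with the associated $K$, the closed-loop system $\dot x=(A+B_2K)x+B_1w$, $z=C_1x$ is strictly negative imaginary (SNI) with degree of stability $\varepsilon$. That is, its transfer function $G_{cl}(s)=C_1(sI-A-B_2K)^{-1}B_1$ has no poles in $\operatorname{Re}s\ge 0$ and satisfies $j\big(G_{cl}(j\omega)-G_{cl}(j\omega)^*\big)>0$ for all $\omega>0$, and all eigenvalues of $A+B_2K$ have real part at most $-\varepsilon$. -/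

import Mathlib

open scoped Matrix ComplexOrder

noncomputable section

namespace NISynthesis

/-- The controlled linear system `ẋ = A x + B₁ w + B₂ u`, `z = C₁ x` with `n` states and `m`
disturbance inputs, `m` control inputs and `m` outputs. -/
structure Plant (n m : ℕ) where
  A : Matrix (Fin n) (Fin n) ℝ
  B₁ : Matrix (Fin n) (Fin m) ℝ
  B₂ : Matrix (Fin n) (Fin m) ℝ
  C₁ : Matrix (Fin m) (Fin n) ℝ

/-- The complex eigenvalues of a real square matrix. -/
def eigenvalues {ι : Type} [Fintype ι] [DecidableEq ι] (M : Matrix ι ι ℝ) : Set ℂ :=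
  spectrum ℂ (M.map (algebraMap ℝ ℂ))

/-! ### Transfer functions and strict negative imaginariness -/

/-- The transfer function matrix `C (s I - A)⁻¹ B`, a matrix of rational functions of `s`. -/
def transferFunction {n m : ℕ} (A : Matrix (Fin n) (Fin n) ℝ) (B : Matrix (Fin n) (Fin m) ℝ)
    (C : Matrix (Fin m) (Fin n) ℝ) : Matrix (Fin m) (Fin m) (RatFunc ℂ) :=
  C.map (fun a => RatFunc.C (a : ℂ)) *
    ((RatFunc.X : RatFunc ℂ) • (1 : Matrix (Fin n) (Fin n) (RatFunc ℂ)) -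
      A.map (fun a => RatFunc.C (a : ℂ)))⁻¹ *
    B.map (fun a => RatFunc.C (a : ℂ))

/-- `s` is a pole of the rational matrix `G`: some entry, in lowest terms, has a denominator that
vanishes at `s`. -/
def IsPole {m : ℕ} (G : Matrix (Fin m) (Fin m) (RatFunc ℂ)) (s : ℂ) : Prop :=
  ∃ i j, (G i j).denom.eval s = 0

/-- The value `G(s)` of a rational matrix at a point that is not a pole. -/
def valueAt {m : ℕ} (G : Matrix (Fin m) (Fin m) (RatFunc ℂ)) (s : ℂ) :
    Matrix (Fin m) (Fin m) ℂ :=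
  G.map (RatFunc.eval (RingHom.id ℂ) s)

/-- Strictly negative imaginary (SNI) transfer function matrices. -/
def IsSNI {m : ℕ} (G : Matrix (Fin m) (Fin m) (RatFunc ℂ)) : Prop :=
  (∀ s : ℂ, 0 ≤ s.re → ¬ IsPole G s) ∧
  ∀ ω : ℝ, 0 < ω → ¬ IsPole G (Complex.I * ω) →
    (Complex.I • (valueAt G (Complex.I * ω) - (valueAt G (Complex.I * ω))ᴴ)).PosDef

/-- The system `ẋ = A x + B w`, `z = C x` is SNI with degree of stability `ε`: its transfer
function is SNI, and all eigenvalues of `A` have real part at most `-ε`. -/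
def IsSNIWithDegree {n m : ℕ} (A : Matrix (Fin n) (Fin n) ℝ) (B : Matrix (Fin n) (Fin m) ℝ)
    (C : Matrix (Fin m) (Fin n) ℝ) (ε : ℝ) : Prop :=
  IsSNI (transferFunction A B C) ∧ ∀ s ∈ eigenvalues A, s.re ≤ -ε

/-- The controllability matrix `[B, A B, …, A^(n-1) B]`. -/
def controllabilityMatrix {n m : ℕ} (A : Matrix (Fin n) (Fin n) ℝ)
    (B : Matrix (Fin n) (Fin m) ℝ) : Matrix (Fin n) (Fin n × Fin m) ℝ :=
  Matrix.of fun i kj => (A ^ (kj.1 : ℕ) * B) i kj.2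

/-- `(A, B)` is controllable. -/
def IsControllable {n m : ℕ} (A : Matrix (Fin n) (Fin n) ℝ) (B : Matrix (Fin n) (Fin m) ℝ) :
    Prop :=
  (controllabilityMatrix A B).rank = n

/-! ### Ordered Schur decompositions -/

/-- An orthogonal change of basis `U` (columns split into `p` and `q`) for which `Uᵀ M U` is block
upper triangular, the `11` block having its eigenvalues in the closed left half plane and the `22`
block being anti-stable. Orthogonality forces `p + q = n`. -/
structure OrderedSchur {n : ℕ} (M : Matrix (Fin n) (Fin n) ℝ) (p q : ℕ) where
  U : Matrix (Fin n) (Fin p ⊕ Fin q) ℝ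
  transpose_mul_self : Uᵀ * U = 1
  mul_transpose_self : U * Uᵀ = 1
  block₂₁ : (Uᵀ * M * U).toBlocks₂₁ = 0
  block₁₁ : ∀ s ∈ eigenvalues (Uᵀ * M * U).toBlocks₁₁, s.re ≤ 0
  block₂₂ : ∀ s ∈ eigenvalues (Uᵀ * M * U).toBlocks₂₂, 0 < s.re

namespace Plant

variable {n m : ℕ} (G : Plant n m)

/-- `R = C₁ B₁ + B₁ᵀ C₁ᵀ`. -/
def R : Matrix (Fin m) (Fin m) ℝ := G.C₁ * G.B₁ + G.B₁ᵀ * G.C₁ᵀ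

/-- `Q = I - B₂ (C₁ B₂)⁻¹ C₁`. -/
def Q : Matrix (Fin n) (Fin n) ℝ := 1 - G.B₂ * (G.C₁ * G.B₂)⁻¹ * G.C₁

/-- `A_q = Q A`. -/
def Aq : Matrix (Fin n) (Fin n) ℝ := G.Q * G.A

/-- `A_r = Q (A + ε I)`. -/
def Ar (ε : ℝ) : Matrix (Fin n) (Fin n) ℝ := G.Q * (G.A + ε • 1)

variable {ε : ℝ} {p q : ℕ}

/-- The block `Ã₂₂`. -/
def A22 (D : OrderedSchur (G.Ar ε) p q) : Matrix (Fin q) (Fin q) ℝ :=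
  (D.Uᵀ * G.Ar ε * D.U).toBlocks₂₂

/-- The block `B̃₂₂` of `Uᵀ B₁`. -/
def B22 (D : OrderedSchur (G.Ar ε) p q) : Matrix (Fin q) (Fin m) ℝ :=
  (D.Uᵀ * G.B₁).toRows₂

/-- The block `C̃₂₂` of `Uᵀ (B₂ (C₁ B₂)⁻¹ - B₁ R⁻¹)`. -/
def C22 (D : OrderedSchur (G.Ar ε) p q) : Matrix (Fin q) (Fin m) ℝ :=
  (D.Uᵀ * (G.B₂ * (G.C₁ * G.B₂)⁻¹ - G.B₁ * G.R⁻¹)).toRows₂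

/-- The Lyapunov conditions on `T ≥ 0` and `S ≥ 0`, with `T - S > 0`. -/
def LyapunovConditions (D : OrderedSchur (G.Ar ε) p q) (T S : Matrix (Fin q) (Fin q) ℝ) : Prop :=
  T.PosSemidef ∧ S.PosSemidef ∧
  -(G.A22 D) * T - T * (G.A22 D)ᵀ + G.C22 D * G.R * (G.C22 D)ᵀ = 0 ∧
  -(G.A22 D) * S - S * (G.A22 D)ᵀ + G.B22 D * G.R⁻¹ * (G.B22 D)ᵀ = 0 ∧
  (T - S).PosDef

variable (ε) in
/-- The Lyapunov conditions can be satisfied for the parameter value `ε`. -/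
def SynthesisConditions : Prop :=
  ∃ (p q : ℕ) (D : OrderedSchur (G.Ar ε) p q) (T S : Matrix (Fin q) (Fin q) ℝ),
    G.LyapunovConditions D T S

/-- `P = U P̃ Uᵀ`, where `P̃` has the only non-zero block `(T - S)⁻¹`. -/
def P (D : OrderedSchur (G.Ar ε) p q) (T S : Matrix (Fin q) (Fin q) ℝ) :
    Matrix (Fin n) (Fin n) ℝ :=
  D.U * (Matrix.fromBlocks 0 0 0 (T - S)⁻¹ : Matrix (Fin p ⊕ Fin q) (Fin p ⊕ Fin q) ℝ) * D.Uᵀ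

/-- The state feedback matrix
`K = (C₁ B₂)⁻¹ (B₁ᵀ P - C₁ A - ε C₁ - R (B₂ᵀ C₁ᵀ)⁻¹ B₂ᵀ P)`. -/
def K (D : OrderedSchur (G.Ar ε) p q) (T S : Matrix (Fin q) (Fin q) ℝ) :
    Matrix (Fin m) (Fin n) ℝ :=
  (G.C₁ * G.B₂)⁻¹ * (G.B₁ᵀ * G.P D T S - G.C₁ * G.A - ε • G.C₁ -
    G.R * (G.B₂ᵀ * G.C₁ᵀ)⁻¹ * G.B₂ᵀ * G.P D T S)

end Plant

end NISynthesis

end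

noncomputable section

namespace NISynthesis

/-! ### Left eigenvectors and characteristic roots -/

section LinearAlgebra

variable {ι K : Type*} [Fintype ι] [DecidableEq ι] [Field K]

/-! Everything is read off left eigenvectors. Write `c` for the row `C₁` and `b` for the column
`B₂`. Since `c Q = 0`, `c` is a left null vector of every `A_r(ε)`. If `v` is a left eigenvector of
`Q A` at `l ≠ 0`, then `v Q` differs from `v` by a multiple of `c`, so correcting `v` by a multiple
of `c` gives a left eigenvector of `A_r(ε)` at `l + ε`, provided `l + ε ≠ 0`. Hence for `0 < ε < γ`
the spectrum of `A_r(ε)` is `0` together with the shifted nonzero `λᵢ`, and only `λₙ + ε` lies in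
the open right half plane: every ordered Schur decomposition has a `1 × 1` anti-stable block.

Let `u` be a left eigenvector at `a > 0`, with `x = u b / (c b)`, `y = u B₁` and `r = R`. Pairing
the Lyapunov equations with `u` gives `2a (T - S) = x (r x - 2 y)`, the `gap` of `u`. Passing from
`A_q` to `A_r(ε)` multiplies the gap by `l / (l + ε) > 0` (`gap_shift`), so solvability at `ε₀`
passes to `ε`.

In the closed loop, `P` has rank one and the plane spanned by `c` and `u` is left invariant, with `c
↦ -ε c + η u` and `u ↦ -(ε + δ) u`, where `τ = T - S`, `η = (y - r x) / τ` and `δ = r x² / (2τ)`.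
The transfer function is therefore `(r/2) / (s + ε + δ) + h / ((s + ε)(s + ε + δ))` with `h = (r x /
2 - y)² / τ > 0`, which is visibly SNI. The other eigenvalues of the closed loop are those of the
first Schur block, moved left by `ε`. -/

theorem mem_spectrum_iff_exists_vecMul {M : Matrix ι ι K} {μ : K} :
    μ ∈ spectrum K M ↔ ∃ v : ι → K, v ≠ 0 ∧ v ᵥ* M = μ • v := by
  rw [spectrum.mem_iff, Matrix.isUnit_iff_isUnit_det, isUnit_iff_ne_zero, not_not,
    ← Matrix.exists_vecMul_eq_zero_iff]
  refine exists_congr fun v => and_congr_right fun _ => ?_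
  rw [Algebra.algebraMap_eq_smul_one, Matrix.vecMul_sub, Matrix.vecMul_smul, Matrix.vecMul_one,
    sub_eq_zero, eq_comm]

/-- A matrix with as many distinct eigenvalues as its size has no other characteristic roots. -/
theorem roots_charpoly_eq_of_injective {M : Matrix ι ι K} {f : ι → K} (hf : Function.Injective f)
    (h : ∀ i, f i ∈ spectrum K M) : M.charpoly.roots = Finset.univ.val.map f := by
  have hle : Finset.univ.val.map f ≤ M.charpoly.roots := by
    rw [Multiset.le_iff_subset (Finset.univ.nodup.map hf)]
    intro x hx
    obtain ⟨i, -, rfl⟩ := Multiset.mem_map.1 hx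
    rw [Polynomial.mem_roots M.charpoly_monic.ne_zero]
    exact Matrix.mem_spectrum_iff_isRoot_charpoly.1 (h i)
  refine (Multiset.eq_of_le_of_card_le hle ?_).symm
  refine (Polynomial.card_roots' _).trans ?_
  rw [Matrix.charpoly_natDegree_eq_dim, Multiset.card_map]
  rfl

/-- If `c` is a left null vector of `Q` and `v` is a left eigenvector of `Q A`, then a combination
of `v` and `c` is a left eigenvector of `Q (A + ε I)`. -/
theorem vecMul_shift {Q A : Matrix ι ι K} {c v : ι → K} {φ l ε : K} (hc : c ᵥ* Q = 0)
    (hv : v ᵥ* Q = v - φ • c) (hl : v ᵥ* (Q * A) = l • v) (hne : l + ε ≠ 0) :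
    (v - (ε * φ / (l + ε)) • c) ᵥ* (Q * (A + ε • 1)) =
      (l + ε) • (v - (ε * φ / (l + ε)) • c) := by
  have h1 : c ᵥ* (Q * (A + ε • 1)) = 0 := by
    rw [← Matrix.vecMul_vecMul, hc, Matrix.zero_vecMul]
  rw [Matrix.sub_vecMul, Matrix.smul_vecMul, h1, mul_add, Matrix.vecMul_add, hl, Matrix.mul_smul,
    Matrix.mul_one, Matrix.vecMul_smul, hv]
  ext i
  simp only [Pi.sub_apply, Pi.add_apply, Pi.smul_apply, smul_eq_mul, Pi.zero_apply]
  field_simp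
  ring

/-- The index types of `U` differ, so their cardinalities are first matched by comparing the traces
of `Uᵀ U` and `U Uᵀ`. -/
theorem charpoly_conj_of_orthogonal {n κ : Type*} [Fintype n] [DecidableEq n] [Fintype κ]
    [DecidableEq κ] {U : Matrix n κ ℝ} (h1 : Uᵀ * U = 1) (h2 : U * Uᵀ = 1) (M : Matrix n n ℝ) :
    (Uᵀ * M * U).charpoly = M.charpoly := by
  have hcard : Fintype.card κ = Fintype.card n := by
    have := Matrix.trace_mul_comm Uᵀ U
    rw [h1, h2, Matrix.trace_one, Matrix.trace_one] at this
    exact_mod_cast this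
  rw [Matrix.mul_assoc, Matrix.charpoly_mul_comm_of_le _ _ hcard.ge, hcard, Nat.sub_self, pow_zero,
    one_mul, Matrix.mul_assoc, h2, Matrix.mul_one]

end LinearAlgebra

/-! ### Complex eigenvalues with multiplicity -/

variable {ι : Type} [Fintype ι] [DecidableEq ι]

/-- The complex roots of the characteristic polynomial of a real matrix, with multiplicity. -/
def eigenvalueMultiset (M : Matrix ι ι ℝ) : Multiset ℂ :=
  (M.map (algebraMap ℝ ℂ)).charpoly.roots

theorem mem_eigenvalueMultiset {M : Matrix ι ι ℝ} {s : ℂ} :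
    s ∈ eigenvalueMultiset M ↔ s ∈ eigenvalues M := by
  rw [eigenvalueMultiset, Polynomial.mem_roots (Matrix.charpoly_monic _).ne_zero, eigenvalues,
    Matrix.mem_spectrum_iff_isRoot_charpoly]

theorem card_eigenvalueMultiset (M : Matrix ι ι ℝ) :
    (eigenvalueMultiset M).card = Fintype.card ι := by
  rw [eigenvalueMultiset, IsAlgClosed.card_roots_eq_natDegree,
    Matrix.charpoly_natDegree_eq_dim]

theorem ofReal_mem_eigenvalues {M : Matrix ι ι ℝ} {a : ℝ} :
    (a : ℂ) ∈ eigenvalues M ↔ a ∈ spectrum ℝ M := by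
  rw [eigenvalues, Matrix.mem_spectrum_iff_isRoot_charpoly, Matrix.mem_spectrum_iff_isRoot_charpoly,
    Matrix.charpoly_map]
  exact Polynomial.isRoot_map_iff (x := a) (f := algebraMap ℝ ℂ) (algebraMap ℝ ℂ).injective

/-- The eigenvalues of a block triangular matrix are those of its diagonal blocks. -/
theorem eigenvalueMultiset_eq_add {n p q : ℕ} {U : Matrix (Fin n) (Fin p ⊕ Fin q) ℝ}
    (h1 : Uᵀ * U = 1) (h2 : U * Uᵀ = 1) {M : Matrix (Fin n) (Fin n) ℝ}
    (h : (Uᵀ * M * U).toBlocks₂₁ = 0) :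
    eigenvalueMultiset M = eigenvalueMultiset (Uᵀ * M * U).toBlocks₁₁ +
      eigenvalueMultiset (Uᵀ * M * U).toBlocks₂₂ := by
  simp only [eigenvalueMultiset, Matrix.charpoly_map]
  rw [← charpoly_conj_of_orthogonal h1 h2 M, ← Polynomial.roots_mul, ← Polynomial.map_mul,
    ← Matrix.charpoly_fromBlocks_zero₂₁ _ (Uᵀ * M * U).toBlocks₁₂, ← h, Matrix.fromBlocks_toBlocks]
  rw [← Polynomial.map_mul]
  exact (((Matrix.charpoly_monic _).mul (Matrix.charpoly_monic _)).map _).ne_zero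

theorem finOne_inv {K : Type*} [Field K] (M : Matrix (Fin 1) (Fin 1) K) :
    M⁻¹ 0 0 = (M 0 0)⁻¹ := by
  rw [Matrix.inv_subsingleton, Matrix.diagonal_apply_eq, Ring.inverse_eq_inv']

/-! ### The spectrum of `A_r(ε)` in terms of that of `A_q` -/

namespace Plant

variable {n : ℕ} (G : Plant n 1)

/-- The output row. -/
def outVec : Fin n → ℝ := G.C₁ 0

/-- The control column. -/
def ctrlVec : Fin n → ℝ := fun i => G.B₂ i 0

/-- The disturbance column. -/
def distVec : Fin n → ℝ := fun i => G.B₁ i 0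

theorem C₁_mul_B₂_apply : (G.C₁ * G.B₂) 0 0 = G.outVec ⬝ᵥ G.ctrlVec := rfl

theorem R_apply : G.R 0 0 = 2 * (G.outVec ⬝ᵥ G.distVec) := by
  rw [R, Matrix.add_apply, two_mul]
  congr 1
  rw [← Matrix.transpose_mul]
  rfl

theorem outVec_dot_ctrlVec_ne_zero (h : IsUnit (G.C₁ * G.B₂)) :
    G.outVec ⬝ᵥ G.ctrlVec ≠ 0 := by
  rw [Matrix.isUnit_iff_isUnit_det, Matrix.det_fin_one] at h
  exact h.ne_zero

theorem Q_apply (i j : Fin n) :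
    G.Q i j = (1 : Matrix (Fin n) (Fin n) ℝ) i j -
      G.ctrlVec i * (G.outVec ⬝ᵥ G.ctrlVec)⁻¹ * G.outVec j := by
  simp only [Q, Matrix.sub_apply, Matrix.mul_apply (M := _ * _), Matrix.mul_apply (M := G.B₂),
    Finset.univ_unique, Finset.sum_singleton, Fin.default_eq_zero, finOne_inv,
    C₁_mul_B₂_apply]
  rfl

theorem Q_eq : G.Q = 1 - (G.outVec ⬝ᵥ G.ctrlVec)⁻¹ • Matrix.vecMulVec G.ctrlVec G.outVec := by
  ext i j
  rw [Q_apply, Matrix.sub_apply, Matrix.smul_apply, Matrix.vecMulVec_apply, smul_eq_mul]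
  ring

theorem vecMul_Q (v : Fin n → ℝ) :
    v ᵥ* G.Q = v - ((v ⬝ᵥ G.ctrlVec) / (G.outVec ⬝ᵥ G.ctrlVec)) • G.outVec := by
  rw [Q_eq, Matrix.vecMul_sub, Matrix.vecMul_one, Matrix.vecMul_smul, Matrix.vecMul_vecMulVec,
    smul_smul, div_eq_inv_mul]

theorem outVec_vecMul_Q (h : IsUnit (G.C₁ * G.B₂)) : G.outVec ᵥ* G.Q = 0 := by
  rw [vecMul_Q, div_self (G.outVec_dot_ctrlVec_ne_zero h), one_smul, sub_self]

theorem outVec_vecMul_Ar (h : IsUnit (G.C₁ * G.B₂)) (ε : ℝ) : G.outVec ᵥ* G.Ar ε = 0 := by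
  rw [Ar, ← Matrix.vecMul_vecMul, outVec_vecMul_Q _ h, Matrix.zero_vecMul]

/-- Every nonzero eigenvalue of `A_q` moves by `ε` in `A_r(ε)`. -/
theorem add_mem_eigenvalues_Ar (h : IsUnit (G.C₁ * G.B₂)) {l : ℂ} (hl : l ∈ eigenvalues G.Aq)
    (hl0 : l ≠ 0) {ε : ℝ} (hne : l + ε ≠ 0) : l + ε ∈ eigenvalues (G.Ar ε) := by
  let f : ℝ →+* ℂ := algebraMap ℝ ℂ
  obtain ⟨v, hv0, hv⟩ := mem_spectrum_iff_exists_vecMul.1 hl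
  let c : Fin n → ℂ := f ∘ G.outVec
  let b : Fin n → ℂ := f ∘ G.ctrlVec
  have hc : c ᵥ* G.Q.map f = 0 := by
    ext i
    have := congrArg f (congrFun (G.outVec_vecMul_Q h) i)
    rw [RingHom.map_vecMul] at this
    simpa using this
  have hvQ : v ᵥ* G.Q.map f = v - ((v ⬝ᵥ b) * f (G.outVec ⬝ᵥ G.ctrlVec)⁻¹) • c := by
    have : G.Q.map f = 1 - f (G.outVec ⬝ᵥ G.ctrlVec)⁻¹ • Matrix.vecMulVec b c := by
      ext i j
      rw [Matrix.map_apply, Q_apply, map_sub, map_mul, map_mul, Matrix.sub_apply,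
        Matrix.smul_apply, Matrix.vecMulVec_apply, smul_eq_mul]
      congr 1
      · simp [Matrix.one_apply, apply_ite f]
      · simp only [c, b, Function.comp_apply]
        ring
    rw [this, Matrix.vecMul_sub, Matrix.vecMul_one, Matrix.vecMul_smul, Matrix.vecMul_vecMulVec,
      smul_smul, mul_comm]
  have hAq : G.Aq.map f = G.Q.map f * G.A.map f := Matrix.map_mul
  have hv' : v ᵥ* (G.Q.map f * G.A.map f) = l • v := by rw [← hAq]; exact hv
  have hcA : c ᵥ* G.Aq.map f = 0 := by
    rw [hAq, ← Matrix.vecMul_vecMul, hc, Matrix.zero_vecMul]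
  have hAr : (G.Ar ε).map f = G.Q.map f * (G.A.map f + (ε : ℂ) • 1) := by
    rw [Ar, Matrix.map_mul]
    congr 1
    ext i j
    by_cases hij : i = j <;> simp [hij, f]
  have heig := vecMul_shift hc hvQ hv' hne
  rw [← hAr] at heig
  refine mem_spectrum_iff_exists_vecMul.2 ⟨_, ?_, heig⟩
  -- The shifted vector vanishes only if `v` is a multiple of `c`; but `c` is killed by `A_q`, which
  -- would force `l v = 0`.
  intro h0
  have hvc := sub_eq_zero.1 h0
  apply hv0
  have h2 : l • v = 0 := by
    rw [← hv', ← hAq, hvc, Matrix.smul_vecMul, hcA, smul_zero]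
  exact (smul_eq_zero.1 h2).resolve_left hl0

theorem zero_mem_eigenvalues_Ar (h : IsUnit (G.C₁ * G.B₂)) (ε : ℝ) :
    (0 : ℂ) ∈ eigenvalues (G.Ar ε) := by
  have := ofReal_mem_eigenvalues.2 <| mem_spectrum_iff_exists_vecMul.2
    ⟨G.outVec, fun h0 => G.outVec_dot_ctrlVec_ne_zero h (by rw [h0, zero_dotProduct]),
      (G.outVec_vecMul_Ar h ε).trans (zero_smul ℝ G.outVec).symm⟩
  simpa using this

/-- If the eigenvalues of `A_q` are distinct, `0` is one of them, exactly one is in the open right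
half plane and the others have real part below `-ε`, then `A_r(ε)` has exactly one eigenvalue with
positive real part, counted with multiplicity. -/
theorem countP_eigenvalueMultiset_Ar (h : IsUnit (G.C₁ * G.B₂)) {lam : Fin n → ℂ}
    (hinj : Function.Injective lam) (hspec : ∀ i, lam i ∈ eigenvalues G.Aq) {ε : ℝ} (hε : 0 < ε)
    {k l : Fin n} (hk : lam k = 0) (hl : 0 < (lam l).re)
    (hother : ∀ i, i ≠ k → i ≠ l → (lam i).re < -ε) :
    (eigenvalueMultiset (G.Ar ε)).countP (fun s => 0 < s.re) = 1 := by
  classical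
  have hne : ∀ i, i ≠ k → lam i + ε ≠ 0 := by
    intro i hi h0
    have h1 : (lam i).re + ε = 0 := by simpa using congrArg Complex.re h0
    by_cases hil : i = l
    · subst hil; linarith
    · linarith [hother i hi hil]
  -- The zero eigenvalue stays put, carried by `c`, while all others move by `ε`. These `n` values
  -- are distinct, so they exhaust the characteristic roots.
  let f : Fin n → ℂ := fun i => if i = k then 0 else lam i + ε
  have hf : Function.Injective f := by
    intro i j hij
    simp only [f] at hij
    split_ifs at hij with h1 h2 h2
    · rw [h1, h2]
    · exact absurd hij.symm (hne j h2)
    · exact absurd hij (hne i h1)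
    · exact hinj (add_right_cancel hij)
  have hmem : ∀ i, f i ∈ eigenvalues (G.Ar ε) := by
    intro i
    simp only [f]
    split_ifs with h1
    · exact G.zero_mem_eigenvalues_Ar h ε
    · exact G.add_mem_eigenvalues_Ar h (hspec i) (fun h0 => h1 (hinj (h0.trans hk.symm))) (hne i h1)
  have hpos : ∀ i, 0 < (f i).re ↔ i = l := by
    intro i
    have hkl : l ≠ k := by rintro rfl; simp [hk] at hl
    simp only [f]
    constructor
    · intro h0
      by_contra hil
      split_ifs at h0 with h1
      · simp at h0
      · have := hother i h1 hil
        simp at h0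
        linarith
    · rintro rfl
      rw [if_neg hkl]
      simp
      linarith
  rw [eigenvalueMultiset, roots_charpoly_eq_of_injective hf hmem, Multiset.countP_map]
  have : Multiset.filter (fun i => 0 < (f i).re) Finset.univ.val
      = (Finset.univ.filter fun i => i = l).val := by
    rw [Finset.filter_val]
    exact Multiset.filter_congr fun i _ => hpos i
  rw [this]
  simp [Finset.filter_eq']

end Plant

/-! ### Quadratic forms and `1 × 1` matrices -/

theorem vecMul_finOne {K : Type*} [CommRing K] (v : Fin 1 → K) (M : Matrix (Fin 1) (Fin 1) K) :
    (v ᵥ* M) 0 = v 0 * M 0 0 := by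
  simp only [Matrix.vecMul, dotProduct, Fintype.sum_unique, Fin.default_eq_zero]

theorem dotProduct_finOne {K : Type*} [CommRing K] (v w : Fin 1 → K) : v ⬝ᵥ w = v 0 * w 0 := by
  simp only [dotProduct, Fintype.sum_unique, Fin.default_eq_zero]

/-- Pairing the Lyapunov equation with a left eigenvector on both sides turns `A` and `Aᵀ` into the
scalar `a`. -/
theorem dotProduct_lyapunov_mulVec {q : ℕ} {A T : Matrix (Fin q) (Fin q) ℝ}
    {C : Matrix (Fin q) (Fin 1) ℝ} {R : Matrix (Fin 1) (Fin 1) ℝ} {w : Fin q → ℝ} {a : ℝ}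
    (hw : w ᵥ* A = a • w) (h : -A * T - T * Aᵀ + C * R * Cᵀ = 0) :
    2 * a * (w ⬝ᵥ T *ᵥ w) = R 0 0 * (w ᵥ* C) 0 ^ 2 := by
  have h1 := congrArg (fun M => w ⬝ᵥ M *ᵥ w) h
  have e1 : w ⬝ᵥ (-A * T) *ᵥ w = -(a * (w ⬝ᵥ T *ᵥ w)) := by
    rw [← Matrix.mulVec_mulVec, Matrix.dotProduct_mulVec, Matrix.vecMul_neg, hw, neg_dotProduct,
      smul_dotProduct, smul_eq_mul]
  have e2 : w ⬝ᵥ (T * Aᵀ) *ᵥ w = a * (w ⬝ᵥ T *ᵥ w) := by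
    rw [← Matrix.mulVec_mulVec, Matrix.mulVec_transpose, hw, Matrix.mulVec_smul, dotProduct_smul,
      smul_eq_mul]
  have e3 : w ⬝ᵥ (C * R * Cᵀ) *ᵥ w = R 0 0 * (w ᵥ* C) 0 ^ 2 := by
    rw [← Matrix.mulVec_mulVec, Matrix.mulVec_transpose, Matrix.dotProduct_mulVec,
      ← Matrix.vecMul_vecMul, dotProduct_finOne, vecMul_finOne]
    ring
  simp only [Matrix.add_mulVec, Matrix.sub_mulVec, dotProduct_add, dotProduct_sub, e1, e2, e3,
    Matrix.zero_mulVec, dotProduct_zero] at h1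
  linarith

theorem posSemidef_finOne {M : Matrix (Fin 1) (Fin 1) ℝ} (h : 0 ≤ M 0 0) : M.PosSemidef := by
  have : M = Matrix.diagonal fun _ => M 0 0 := by
    ext i j; fin_cases i; fin_cases j; rfl
  rw [this]
  exact Matrix.PosSemidef.diagonal fun _ => h

theorem posDef_finOne {K : Type*} [RCLike K] {M : Matrix (Fin 1) (Fin 1) K} (h : 0 < M 0 0) :
    M.PosDef := by
  have : M = Matrix.diagonal fun _ => M 0 0 := by
    ext i j; fin_cases i; fin_cases j; rfl
  rw [this]
  exact Matrix.PosDef.diagonal fun _ => h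

/-! ### Left eigenvectors seen through the Schur blocks -/

namespace OrderedSchur

variable {n p q : ℕ} {M : Matrix (Fin n) (Fin n) ℝ} (D : OrderedSchur M p q)

/-- The combination of the last `q` columns of `U` with coefficients `w`. -/
def lift (w : Fin q → ℝ) : Fin n → ℝ := Sum.elim (0 : Fin p → ℝ) w ᵥ* D.Uᵀ

theorem vecMul_blocks_inl (y : Fin p ⊕ Fin q → ℝ) :
    (y ᵥ* (D.Uᵀ * M * D.U)) ∘ Sum.inl = (y ∘ Sum.inl) ᵥ* (D.Uᵀ * M * D.U).toBlocks₁₁ := by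
  conv_lhs => rw [← Matrix.fromBlocks_toBlocks (D.Uᵀ * M * D.U), D.block₂₁,
    Matrix.vecMul_fromBlocks]
  simp

theorem vecMul_blocks (w : Fin q → ℝ) :
    Sum.elim (0 : Fin p → ℝ) w ᵥ* (D.Uᵀ * M * D.U) =
      Sum.elim (0 : Fin p → ℝ) (w ᵥ* (D.Uᵀ * M * D.U).toBlocks₂₂) := by
  conv_lhs => rw [← Matrix.fromBlocks_toBlocks (D.Uᵀ * M * D.U), D.block₂₁,
    Matrix.vecMul_fromBlocks]
  simp

theorem lift_vecMul (w : Fin q → ℝ) :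
    D.lift w ᵥ* M = D.lift (w ᵥ* (D.Uᵀ * M * D.U).toBlocks₂₂) := by
  rw [lift, lift, ← vecMul_blocks, Matrix.vecMul_vecMul, Matrix.vecMul_vecMul, Matrix.mul_assoc,
    D.mul_transpose_self, Matrix.mul_one]

/-- Left eigenvectors at positive eigenvalues come from the anti-stable block. -/
theorem exists_eq_lift {u : Fin n → ℝ} {a : ℝ} (hu : u ≠ 0) (ha : 0 < a) (h : u ᵥ* M = a • u) :
    ∃ w : Fin q → ℝ, w ≠ 0 ∧ u = D.lift w ∧ w ᵥ* (D.Uᵀ * M * D.U).toBlocks₂₂ = a • w := by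
  set y := u ᵥ* D.U with hy
  have hyu : y ᵥ* D.Uᵀ = u := by
    rw [hy, Matrix.vecMul_vecMul, D.mul_transpose_self, Matrix.vecMul_one]
  have hyN : y ᵥ* (D.Uᵀ * M * D.U) = a • y := by
    rw [← Matrix.vecMul_vecMul, ← Matrix.vecMul_vecMul, hyu, h, Matrix.smul_vecMul]
  -- A nonzero first component would be a left eigenvector of the `11` block at `a > 0`.
  have h0 : y ∘ Sum.inl = 0 := by
    by_contra hne
    have h1 : (y ∘ Sum.inl) ᵥ* (D.Uᵀ * M * D.U).toBlocks₁₁ = a • (y ∘ Sum.inl) := by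
      rw [← vecMul_blocks_inl, hyN]; rfl
    have := D.block₁₁ a (ofReal_mem_eigenvalues.2
      (mem_spectrum_iff_exists_vecMul.2 ⟨_, hne, h1⟩))
    rw [Complex.ofReal_re] at this
    linarith
  have hye : y = Sum.elim (0 : Fin p → ℝ) (y ∘ Sum.inr) := by rw [← h0, Sum.elim_comp_inl_inr]
  refine ⟨y ∘ Sum.inr, ?_, ?_, ?_⟩
  · intro h2
    rw [h2] at hye
    apply hu
    rw [← hyu, hye]
    ext i
    simp [Matrix.vecMul, dotProduct]
  · rw [lift, ← hye, hyu]
  · rw [hye, vecMul_blocks] at hyN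
    ext i
    exact congrFun hyN (Sum.inr i)

/-- This makes `q` an invariant of `M`, the same for every decomposition. -/
theorem countP_eigenvalueMultiset (D : OrderedSchur M p q) :
    (eigenvalueMultiset M).countP (fun s => 0 < s.re) = q := by
  rw [eigenvalueMultiset_eq_add D.transpose_mul_self D.mul_transpose_self D.block₂₁,
    Multiset.countP_add, Multiset.countP_eq_zero.2, Multiset.countP_eq_card.2,
    card_eigenvalueMultiset, Fintype.card_fin, zero_add]
  · exact fun s hs => D.block₂₂ s (mem_eigenvalueMultiset.1 hs)
  · exact fun s hs => (D.block₁₁ s (mem_eigenvalueMultiset.1 hs)).not_gt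

end OrderedSchur

/-! ### The gap and the Lyapunov conditions -/

namespace Plant

variable {n : ℕ} (G : Plant n 1)

/-- The quantity `(u B₂ / C₁ B₂) (R (u B₂ / C₁ B₂) - 2 u B₁)`, whose sign decides the solvability
of the Lyapunov conditions in the direction `u`. -/
def gap (u : Fin n → ℝ) : ℝ :=
  (u ⬝ᵥ G.ctrlVec) / (G.outVec ⬝ᵥ G.ctrlVec) *
    (G.R 0 0 * ((u ⬝ᵥ G.ctrlVec) / (G.outVec ⬝ᵥ G.ctrlVec)) - 2 * (u ⬝ᵥ G.distVec))

theorem gap_smul (k : ℝ) (u : Fin n → ℝ) : G.gap (k • u) = k ^ 2 * G.gap u := by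
  simp only [gap, smul_dotProduct, smul_eq_mul]
  ring

/-- Since `R = 2 c B₁`, subtracting a multiple of `c` leaves the factor `R x - 2 u B₁` unchanged,
while `x` is multiplied by `1 - ε / (l + ε)`. -/
theorem gap_shift (h : IsUnit (G.C₁ * G.B₂)) {v : Fin n → ℝ} {l ε : ℝ} (hl : l + ε ≠ 0) :
    G.gap (v - (ε * ((v ⬝ᵥ G.ctrlVec) / (G.outVec ⬝ᵥ G.ctrlVec)) / (l + ε)) • G.outVec) =
      l / (l + ε) * G.gap v := by
  have hcb := G.outVec_dot_ctrlVec_ne_zero h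
  simp only [gap, sub_dotProduct, smul_dotProduct, smul_eq_mul, R_apply]
  field_simp
  ring

variable {ε : ℝ} {p q : ℕ}

theorem vecMul_C22 (D : OrderedSchur (G.Ar ε) p q) (w : Fin q → ℝ) :
    (w ᵥ* G.C22 D) 0 = (D.lift w ⬝ᵥ G.ctrlVec) / (G.outVec ⬝ᵥ G.ctrlVec) -
      (D.lift w ⬝ᵥ G.distVec) / G.R 0 0 := by
  have h1 : w ᵥ* G.C22 D = D.lift w ᵥ* (G.B₂ * (G.C₁ * G.B₂)⁻¹ - G.B₁ * G.R⁻¹) := by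
    rw [OrderedSchur.lift, Matrix.vecMul_vecMul]
    ext i
    simp [Matrix.vecMul, dotProduct, C22, Matrix.toRows₂]
  rw [h1, Matrix.vecMul_sub, Pi.sub_apply, ← Matrix.vecMul_vecMul, ← Matrix.vecMul_vecMul,
    vecMul_finOne, vecMul_finOne, finOne_inv, finOne_inv, C₁_mul_B₂_apply, div_eq_mul_inv,
    div_eq_mul_inv]
  rfl

theorem vecMul_B22 (D : OrderedSchur (G.Ar ε) p q) (w : Fin q → ℝ) :
    (w ᵥ* G.B22 D) 0 = D.lift w ⬝ᵥ G.distVec := by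
  have h1 : w ᵥ* G.B22 D = D.lift w ᵥ* G.B₁ := by
    rw [OrderedSchur.lift, Matrix.vecMul_vecMul]
    ext i
    simp [Matrix.vecMul, dotProduct, B22, Matrix.toRows₂]
  rw [h1]
  rfl

/-- Along a left eigenvector of the anti-stable block, solutions of the Lyapunov equations
satisfy `2 a w (T - S) wᵀ = gap`. -/
theorem two_mul_dotProduct_sub_mulVec (hR : 0 < G.R 0 0) (D : OrderedSchur (G.Ar ε) p q)
    {T S : Matrix (Fin q) (Fin q) ℝ}
    (hT : -(G.A22 D) * T - T * (G.A22 D)ᵀ + G.C22 D * G.R * (G.C22 D)ᵀ = 0)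
    (hS : -(G.A22 D) * S - S * (G.A22 D)ᵀ + G.B22 D * G.R⁻¹ * (G.B22 D)ᵀ = 0)
    {w : Fin q → ℝ} {a : ℝ} (hw : w ᵥ* G.A22 D = a • w) :
    2 * a * (w ⬝ᵥ (T - S) *ᵥ w) = G.gap (D.lift w) := by
  have h1 := dotProduct_lyapunov_mulVec hw hT
  have h2 := dotProduct_lyapunov_mulVec hw hS
  rw [vecMul_C22] at h1
  rw [vecMul_B22, finOne_inv] at h2
  rw [Matrix.sub_mulVec, dotProduct_sub, mul_sub, h1, h2, gap]
  field_simp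
  ring

/-- Necessity, for an anti-stable block of any size: at `ε₀` nothing bounds `q`. -/
theorem gap_pos_of_lyapunovConditions (hR : 0 < G.R 0 0) (D : OrderedSchur (G.Ar ε) p q)
    {T S : Matrix (Fin q) (Fin q) ℝ} (h : G.LyapunovConditions D T S) {u : Fin n → ℝ} {a : ℝ}
    (hu : u ≠ 0) (ha : 0 < a) (hua : u ᵥ* G.Ar ε = a • u) : 0 < G.gap u := by
  obtain ⟨w, hw0, rfl, hw⟩ := D.exists_eq_lift hu ha hua
  rw [← G.two_mul_dotProduct_sub_mulVec hR D h.2.2.1 h.2.2.2.1 hw]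
  have := h.2.2.2.2.dotProduct_mulVec_pos hw0
  rw [star_trivial] at this
  positivity

theorem A22_pos (D : OrderedSchur (G.Ar ε) p 1) : 0 < G.A22 D 0 0 := by
  have := D.block₂₂ (G.A22 D 0 0) (ofReal_mem_eigenvalues.2
    (mem_spectrum_iff_exists_vecMul.2 ⟨1, one_ne_zero, ?_⟩))
  · simpa using this
  · ext i
    fin_cases i
    simp [Matrix.vecMul, dotProduct, A22]

theorem one_vecMul_A22 (D : OrderedSchur (G.Ar ε) p 1) :
    (1 : Fin 1 → ℝ) ᵥ* G.A22 D = G.A22 D 0 0 • 1 := by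
  ext i
  fin_cases i
  simp [Matrix.vecMul, dotProduct]

/-- Sufficiency for `q = 1`: the equations are scalar and linear with leading coefficient `2 Ã₂₂ >
0`, and the sign of `T - S` is that of the gap. -/
theorem exists_lyapunovConditions (hR : 0 < G.R 0 0) (D : OrderedSchur (G.Ar ε) p 1)
    (h : 0 < G.gap (D.lift 1)) : ∃ T S, G.LyapunovConditions D T S := by
  have ha := G.A22_pos D
  have hT : -(G.A22 D) * (Matrix.of fun _ _ => G.R 0 0 * G.C22 D 0 0 ^ 2 / (2 * G.A22 D 0 0)) -
      (Matrix.of fun _ _ => G.R 0 0 * G.C22 D 0 0 ^ 2 / (2 * G.A22 D 0 0)) * (G.A22 D)ᵀ +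
      G.C22 D * G.R * (G.C22 D)ᵀ = 0 := by
    ext i j
    fin_cases i; fin_cases j
    simp [Matrix.mul_apply]
    field_simp
    ring
  have hS : -(G.A22 D) * (Matrix.of fun _ _ => G.B22 D 0 0 ^ 2 / (2 * G.A22 D 0 0 * G.R 0 0)) -
      (Matrix.of fun _ _ => G.B22 D 0 0 ^ 2 / (2 * G.A22 D 0 0 * G.R 0 0)) * (G.A22 D)ᵀ +
      G.B22 D * G.R⁻¹ * (G.B22 D)ᵀ = 0 := by
    ext i j
    fin_cases i; fin_cases j
    have := finOne_inv G.R
    simp [Matrix.mul_apply, -Matrix.inv_subsingleton, this]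
    field_simp
    ring
  refine ⟨_, _, posSemidef_finOne ?_, posSemidef_finOne ?_, hT, hS, posDef_finOne ?_⟩
  · rw [Matrix.of_apply]; positivity
  · rw [Matrix.of_apply]; positivity
  · rw [← G.two_mul_dotProduct_sub_mulVec hR D hT hS (G.one_vecMul_A22 D)] at h
    have := pos_of_mul_pos_right h (by positivity)
    simpa [Matrix.mulVec, dotProduct] using this

end Plant

theorem eigenvalues_sub_smul_one {ι : Type} [Fintype ι] [DecidableEq ι] {M : Matrix ι ι ℝ} {ε : ℝ}
    {s : ℂ} (h : s ∈ eigenvalues (M - ε • 1)) : s + ε ∈ eigenvalues M := by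
  rw [eigenvalues, spectrum.mem_iff] at h ⊢
  convert h using 2
  ext i j
  by_cases hij : i = j
  · simp [Matrix.algebraMap_matrix_apply, hij]
    ring
  · simp [Matrix.algebraMap_matrix_apply, hij]

/-! ### Second order transfer functions -/

section TransferFunction

open Polynomial in
/-- A first order numerator over `(s + e) (s + f)` with suitable signs is strictly negative
imaginary. -/
theorem isSNI_of_eq_div {H : Matrix (Fin 1) (Fin 1) (RatFunc ℂ)} {e f ρ h : ℝ} (he : 0 < e)
    (hf : 0 < f) (hρ : 0 < ρ) (hh : 0 < h)
    (hH : H 0 0 = algebraMap ℂ[X] (RatFunc ℂ) (C (ρ : ℂ) * (X + C (e : ℂ)) + C (h : ℂ)) /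
      algebraMap ℂ[X] (RatFunc ℂ) ((X + C (e : ℂ)) * (X + C (f : ℂ)))) : IsSNI H := by
  set N : ℂ[X] := C (ρ : ℂ) * (X + C (e : ℂ)) + C (h : ℂ) with hN
  set E : ℂ[X] := (X + C (e : ℂ)) * (X + C (f : ℂ)) with hE
  have hE0 : E ≠ 0 := mul_ne_zero (X_add_C_ne_zero _) (X_add_C_ne_zero _)
  have hden : (H 0 0).denom ∣ E := by rw [hH]; exact RatFunc.denom_div_dvd _ _
  have hnp : ∀ s : ℂ, 0 ≤ s.re → (H 0 0).denom.eval s ≠ 0 := by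
    intro s hs h0
    have h1 : E.eval s = 0 := eval_eq_zero_of_dvd_of_eval_eq_zero hden h0
    rw [hE, eval_mul, mul_eq_zero] at h1
    rcases h1 with h1 | h1 <;>
    · have := congrArg Complex.re h1
      simp at this
      linarith
  refine ⟨?_, fun ω hω _ => posDef_finOne ?_⟩
  · rintro s hs ⟨i, j, hij⟩
    fin_cases i; fin_cases j
    exact hnp s hs hij
  · set s : ℂ := Complex.I * ω with hs
    have hre : s.re = 0 := by simp [hs]
    have him : s.im = ω := by simp [hs]
    have hmul : H 0 0 * algebraMap ℂ[X] (RatFunc ℂ) E = algebraMap ℂ[X] (RatFunc ℂ) N := by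
      rw [hH, div_mul_cancel₀]
      exact RatFunc.algebraMap_ne_zero hE0
    -- Evaluation is multiplicative only where the reduced denominators do not vanish, hence the use
    -- of `hnp`.
    have hev : RatFunc.eval (RingHom.id ℂ) s (H 0 0) * E.eval s = N.eval s := by
      have := congrArg (RatFunc.eval (RingHom.id ℂ) s) hmul
      rw [RatFunc.eval_mul, RatFunc.eval_algebraMap, RatFunc.eval_algebraMap] at this
      · exact this
      · exact hnp s hre.ge
      · simp [RatFunc.denom_algebraMap]
    set g := RatFunc.eval (RingHom.id ℂ) s (H 0 0) with hg
    have hgim : g.im < 0 := by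
      have h1 : g * (((s + e) * (s + f))) = ρ * (s + e) + h := by
        simpa [hE, hN] using hev
      have hr := congrArg Complex.re h1
      have hi := congrArg Complex.im h1
      simp [hre, him] at hr hi
      -- Imaginary part after multiplying by the conjugate of `(s + e)(s + f)` at `s = iω`.
      have key : g.im * ((e ^ 2 + ω ^ 2) * (f ^ 2 + ω ^ 2)) =
          -(ρ * ω * (e ^ 2 + ω ^ 2) + h * ω * (e + f)) := by
        linear_combination (e * f - ω ^ 2) * hi - (ω * e + ω * f) * hr
      by_contra hcon
      have : 0 ≤ g.im * ((e ^ 2 + ω ^ 2) * (f ^ 2 + ω ^ 2)) :=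
        mul_nonneg (not_lt.1 hcon) (by positivity)
      have : 0 < ρ * ω * (e ^ 2 + ω ^ 2) + h * ω * (e + f) := by positivity
      linarith
    have hval : (Complex.I • (valueAt H s - (valueAt H s)ᴴ)) 0 0 = ((-2 * g.im : ℝ) : ℂ) := by
      simp only [valueAt, Matrix.smul_apply, Matrix.sub_apply, Matrix.conjTranspose_apply,
        Matrix.map_apply, ← hg]
      apply Complex.ext <;> simp
      ring
    rw [hval, Complex.zero_lt_real]
    linarith

open Polynomial in
/-- If the output row `c` spans together with `u` a left invariant plane, the transfer function
is of second order. -/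
theorem transferFunction_eq_div {n : ℕ} {A : Matrix (Fin n) (Fin n) ℝ}
    {B : Matrix (Fin n) (Fin 1) ℝ} {C₀ : Matrix (Fin 1) (Fin n) ℝ} {u : Fin n → ℝ} {e f η : ℝ}
    (hc : C₀ 0 ᵥ* A = -(e • C₀ 0) + η • u) (hu : u ᵥ* A = -(f • u)) :
    transferFunction A B C₀ 0 0 =
      algebraMap ℂ[X] (RatFunc ℂ) (C (((C₀ 0 ⬝ᵥ fun i => B i 0) : ℝ) : ℂ) * (X + C (f : ℂ)) +
        C ((η * (u ⬝ᵥ fun i => B i 0) : ℝ) : ℂ)) /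
      algebraMap ℂ[X] (RatFunc ℂ) ((X + C (e : ℂ)) * (X + C (f : ℂ))) := by
  let φ : ℝ →+* RatFunc ℂ := (RatFunc.C : ℂ →+* RatFunc ℂ).comp (algebraMap ℝ ℂ)
  have hφ : ∀ a : ℝ, RatFunc.C (a : ℂ) = φ a := fun _ => rfl
  set N : Matrix (Fin n) (Fin n) (RatFunc ℂ) := (RatFunc.X : RatFunc ℂ) • 1 - A.map φ with hN
  have hX : ∀ a : ℝ, (RatFunc.X : RatFunc ℂ) + φ a ≠ 0 := by
    intro a
    have : (RatFunc.X : RatFunc ℂ) + φ a = algebraMap ℂ[X] (RatFunc ℂ) (X + C (a : ℂ)) := by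
      simp [φ]
    rw [this]
    exact RatFunc.algebraMap_ne_zero (X_add_C_ne_zero _)
  have hdet : IsUnit N.det := by
    rw [isUnit_iff_ne_zero]
    have : N.det = algebraMap ℂ[X] (RatFunc ℂ) (A.map (algebraMap ℝ ℂ)).charpoly := by
      rw [Matrix.charpoly, RingHom.map_det]
      congr 1
      ext i j
      by_cases hij : i = j <;> simp [hN, hij, φ]
    rw [this]
    exact RatFunc.algebraMap_ne_zero (Matrix.charpoly_monic _).ne_zero
  have hcN : (φ ∘ C₀ 0) ᵥ* N = (RatFunc.X + φ e) • (φ ∘ C₀ 0) - φ η • (φ ∘ u) := by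
    ext i
    have := congrArg φ (congrFun hc i)
    rw [RingHom.map_vecMul] at this
    rw [hN, Matrix.vecMul_sub, Pi.sub_apply, this, Matrix.vecMul_smul, Matrix.vecMul_one]
    simp
    ring
  have huN : (φ ∘ u) ᵥ* N = (RatFunc.X + φ f) • (φ ∘ u) := by
    ext i
    have := congrArg φ (congrFun hu i)
    rw [RingHom.map_vecMul] at this
    rw [hN, Matrix.vecMul_sub, Pi.sub_apply, this, Matrix.vecMul_smul, Matrix.vecMul_one]
    simp
    ring
  -- The row `c (sI - A)⁻¹`, found by solving a triangular system in the span of `c` and `u`.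
  have hz : ((RatFunc.X + φ e)⁻¹ • (φ ∘ C₀ 0) +
      (φ η / ((RatFunc.X + φ e) * (RatFunc.X + φ f))) • (φ ∘ u)) ᵥ* N = φ ∘ C₀ 0 := by
    rw [Matrix.add_vecMul, Matrix.smul_vecMul, Matrix.smul_vecMul, hcN, huN]
    have := hX e
    have := hX f
    ext i
    simp
    field_simp
    ring
  have hinv : (φ ∘ C₀ 0) ᵥ* N⁻¹ = (RatFunc.X + φ e)⁻¹ • (φ ∘ C₀ 0) +
      (φ η / ((RatFunc.X + φ e) * (RatFunc.X + φ f))) • (φ ∘ u) := by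
    -- The rewrite also hits the `c` on the right-hand side; the final `rw [hz]` restores it.
    rw [← hz, Matrix.vecMul_vecMul, Matrix.mul_nonsing_inv _ hdet, Matrix.vecMul_one]
    rw [hz]
  have hdot : ∀ v : Fin n → ℝ, (φ ∘ v) ⬝ᵥ (fun i => φ (B i 0)) = φ (v ⬝ᵥ fun i => B i 0) :=
    fun v => (RingHom.map_dotProduct φ v _).symm
  have hval : transferFunction A B C₀ 0 0 = ((φ ∘ C₀ 0) ᵥ* N⁻¹) ⬝ᵥ fun i => φ (B i 0) := rfl
  have hp : ∀ a : ℝ, algebraMap ℂ[X] (RatFunc ℂ) (C (a : ℂ)) = φ a := by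
    intro a; simp [φ]
  rw [hval, hinv, add_dotProduct, smul_dotProduct, smul_dotProduct, hdot, hdot]
  simp only [map_add, map_mul, hp, RatFunc.algebraMap_X, smul_eq_mul]
  have := hX e
  have := hX f
  field_simp

end TransferFunction

/-! ### The closed loop -/

namespace Plant

variable {n : ℕ} (G : Plant n 1) {ε : ℝ} {p : ℕ}

theorem lift_one_apply {M : Matrix (Fin n) (Fin n) ℝ} (D : OrderedSchur M p 1) (i : Fin n) :
    D.lift 1 i = D.U i (Sum.inr 0) := by
  simp [OrderedSchur.lift, Matrix.vecMul, dotProduct]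

theorem P_eq (D : OrderedSchur (G.Ar ε) p 1) (T S : Matrix (Fin 1) (Fin 1) ℝ) :
    G.P D T S = ((T - S) 0 0)⁻¹ • Matrix.vecMulVec (D.lift 1) (D.lift 1) := by
  ext i j
  simp only [P, Matrix.mul_apply (N := D.Uᵀ), Matrix.mul_apply (M := D.U), Fintype.sum_sum_type]
  simp [Matrix.vecMulVec_apply, lift_one_apply]
  ring

/-- The closed loop is a rank one perturbation of `A_r(ε) - ε I`. -/
theorem closedLoop_eq (h : IsUnit (G.C₁ * G.B₂)) (D : OrderedSchur (G.Ar ε) p 1)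
    (T S : Matrix (Fin 1) (Fin 1) ℝ) :
    G.A + G.B₂ * G.K D T S = G.Ar ε - ε • 1 +
      ((G.outVec ⬝ᵥ G.ctrlVec)⁻¹ * (((T - S) 0 0)⁻¹ * (D.lift 1 ⬝ᵥ G.distVec -
        G.R 0 0 * ((D.lift 1 ⬝ᵥ G.ctrlVec) / (G.outVec ⬝ᵥ G.ctrlVec))))) •
        Matrix.vecMulVec G.ctrlVec (D.lift 1) := by
  have hcb := G.outVec_dot_ctrlVec_ne_zero h
  set u := D.lift 1 with hu
  set τ := (T - S) 0 0
  have hAr : G.Ar ε = G.A + ε • 1 - (G.outVec ⬝ᵥ G.ctrlVec)⁻¹ •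
      Matrix.vecMulVec G.ctrlVec (G.outVec ᵥ* G.A + ε • G.outVec) := by
    rw [Ar, Q_eq, sub_mul, one_mul, Matrix.smul_mul, Matrix.vecMulVec_mul, Matrix.vecMul_add,
      Matrix.vecMul_smul, Matrix.vecMul_one]
  have hT : (G.B₂ᵀ * G.C₁ᵀ)⁻¹ 0 0 = (G.outVec ⬝ᵥ G.ctrlVec)⁻¹ := by
    rw [finOne_inv, ← Matrix.transpose_mul]
    rfl
  have hP : ∀ (B : Matrix (Fin n) (Fin 1) ℝ) (j : Fin n), (Bᵀ * G.P D T S) 0 j =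
      τ⁻¹ * (u ⬝ᵥ fun i => B i 0) * u j := by
    intro B j
    have : (Bᵀ * G.P D T S) 0 j = ((fun i => B i 0) ᵥ* G.P D T S) j := rfl
    rw [this, P_eq, Matrix.vecMul_smul, Matrix.vecMul_vecMulVec, smul_smul, dotProduct_comm]
    rfl
  have hK : ∀ j, G.K D T S 0 j = (G.outVec ⬝ᵥ G.ctrlVec)⁻¹ *
      (τ⁻¹ * (u ⬝ᵥ G.distVec) * u j - (G.outVec ᵥ* G.A) j - ε * G.outVec j -
        G.R 0 0 * (G.outVec ⬝ᵥ G.ctrlVec)⁻¹ * (τ⁻¹ * (u ⬝ᵥ G.ctrlVec) * u j)) := by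
    intro j
    have h2 : (G.R * (G.B₂ᵀ * G.C₁ᵀ)⁻¹ * G.B₂ᵀ * G.P D T S) 0 j =
        G.R 0 0 * (G.outVec ⬝ᵥ G.ctrlVec)⁻¹ * (τ⁻¹ * (u ⬝ᵥ G.ctrlVec) * u j) := by
      rw [Matrix.mul_assoc _ G.B₂ᵀ, Matrix.mul_apply, Fintype.sum_unique, Matrix.mul_apply,
        Fintype.sum_unique]
      simp only [Fin.default_eq_zero]
      rw [hT, hP]
      rfl
    rw [K, Matrix.mul_apply, Fintype.sum_unique]
    simp only [Fin.default_eq_zero]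
    rw [finOne_inv, C₁_mul_B₂_apply, Matrix.sub_apply, Matrix.sub_apply, Matrix.sub_apply, h2, hP]
    rfl
  ext i j
  have hBK : (G.B₂ * G.K D T S) i j = G.ctrlVec i * G.K D T S 0 j := by
    rw [Matrix.mul_apply, Fintype.sum_unique]
    rfl
  rw [Matrix.add_apply, hBK, hK, hAr]
  simp only [Matrix.add_apply, Matrix.sub_apply, Matrix.smul_apply, Matrix.vecMulVec_apply,
    Pi.add_apply, Pi.smul_apply, smul_eq_mul]
  field_simp
  ring

/-- The synthesis theorem when the anti-stable block has size one. -/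
theorem isSNIWithDegree_closedLoop (h : IsUnit (G.C₁ * G.B₂)) (hR : 0 < G.R 0 0) (hε : 0 < ε)
    (D : OrderedSchur (G.Ar ε) p 1) {T S : Matrix (Fin 1) (Fin 1) ℝ}
    (hL : G.LyapunovConditions D T S) :
    IsSNIWithDegree (G.A + G.B₂ * G.K D T S) G.B₁ G.C₁ ε := by
  have hcb := G.outVec_dot_ctrlVec_ne_zero h
  have ha := G.A22_pos D
  have hτ : 0 < (T - S) 0 0 := hL.2.2.2.2.diag_pos
  have hgap := G.two_mul_dotProduct_sub_mulVec hR D hL.2.2.1 hL.2.2.2.1 (G.one_vecMul_A22 D)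
  have hquad : (1 : Fin 1 → ℝ) ⬝ᵥ (T - S) *ᵥ 1 = (T - S) 0 0 := by
    simp [Matrix.mulVec, dotProduct]
  have huA : D.lift 1 ᵥ* G.Ar ε = G.A22 D 0 0 • D.lift 1 := by
    have := D.lift_vecMul 1
    rw [show (D.Uᵀ * G.Ar ε * D.U).toBlocks₂₂ = G.A22 D from rfl, G.one_vecMul_A22 D] at this
    rw [this]
    ext i
    simp [OrderedSchur.lift, Matrix.vecMul, dotProduct]
  have hUu : D.lift 1 ᵥ* D.U = Sum.elim (0 : Fin p → ℝ) (1 : Fin 1 → ℝ) := by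
    rw [OrderedSchur.lift, Matrix.vecMul_vecMul, D.transpose_mul_self, Matrix.vecMul_one]
  have hcA := G.outVec_vecMul_Ar h ε
  have hcl := G.closedLoop_eq h D T S
  rw [hquad, gap] at hgap
  set u := D.lift 1 with hu
  set a := G.A22 D 0 0 with ha'
  set τ := (T - S) 0 0
  set x := (u ⬝ᵥ G.ctrlVec) / (G.outVec ⬝ᵥ G.ctrlVec) with hx
  set y := u ⬝ᵥ G.distVec with hy
  set r := G.R 0 0 with hr
  set η := τ⁻¹ * (y - r * x) with hη
  have hub : u ⬝ᵥ G.ctrlVec = x * (G.outVec ⬝ᵥ G.ctrlVec) := by rw [hx]; field_simp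
  have hx0 : x * (r * x - 2 * y) ≠ 0 := by rw [← hgap]; positivity
  have hx1 : x ≠ 0 := left_ne_zero_of_mul hx0
  have hx2 : r * x - 2 * y ≠ 0 := right_ne_zero_of_mul hx0
  set δ := r * x ^ 2 / (2 * τ) with hδ
  have hδ0 : 0 < δ := by positivity
  have haδ : a + η * x = -δ := by
    rw [hη, hδ]
    field_simp
    linear_combination hgap
  set Acl := G.A + G.B₂ * G.K D T S
  have hc : G.C₁ 0 ᵥ* Acl = -(ε • G.C₁ 0) + η • u := by
    change G.outVec ᵥ* Acl = -(ε • G.outVec) + η • u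
    rw [hcl, Matrix.vecMul_add, Matrix.vecMul_sub, hcA, Matrix.vecMul_smul, Matrix.vecMul_one,
      Matrix.vecMul_smul, Matrix.vecMul_vecMulVec, smul_smul, zero_sub]
    congr 2
    field_simp
  have huc : u ᵥ* Acl = -((ε + δ) • u) := by
    rw [hcl, Matrix.vecMul_add, Matrix.vecMul_sub, huA, Matrix.vecMul_smul, Matrix.vecMul_one,
      Matrix.vecMul_smul, Matrix.vecMul_vecMulVec, smul_smul, hub, ← sub_smul, ← add_smul,
      ← neg_smul]
    congr 1
    field_simp
    linear_combination haδ
  constructor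
  -- This is `η y + (r/2) δ`, the remainder when the numerator is expanded around `s + ε` instead of
  -- `s + ε + δ`. It completes a square, nonzero because the gap is.
  · have hh : 0 < τ⁻¹ * (r * x / 2 - y) ^ 2 := by
      have : r * x / 2 - y ≠ 0 := fun h0 => hx2 (by linarith)
      positivity
    refine isSNI_of_eq_div hε (add_pos hε hδ0) (half_pos hR) hh ?_
    rw [transferFunction_eq_div hc huc]
    congr 2
    have h1 : (G.C₁ 0 ⬝ᵥ fun i => G.B₁ i 0) = r / 2 := by
      rw [hr, R_apply, mul_div_cancel_left₀ _ two_ne_zero]; rfl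
    have h2 : η * (u ⬝ᵥ fun i => G.B₁ i 0) = τ⁻¹ * (r * x / 2 - y) ^ 2 - r / 2 * δ := by
      change η * y = _
      rw [hη, hδ]
      field_simp
      ring
    rw [h1, h2]
    simp only [Complex.ofReal_sub, Complex.ofReal_mul, Complex.ofReal_add, map_sub, map_mul,
      map_add]
    ring
  · intro s hs
    set κ := (G.outVec ⬝ᵥ G.ctrlVec)⁻¹ * η with hκ
    -- In the Schur basis `u` is the last coordinate row, so the rank one term only alters the last
    -- column: triangularity survives and the `11` block is merely shifted.
    have hconj : D.Uᵀ * Acl * D.U = D.Uᵀ * G.Ar ε * D.U - ε • 1 +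
        κ • Matrix.vecMulVec (D.Uᵀ *ᵥ G.ctrlVec) (Sum.elim (0 : Fin p → ℝ) (1 : Fin 1 → ℝ)) := by
      rw [hcl, Matrix.mul_add, Matrix.mul_sub, Matrix.add_mul, Matrix.sub_mul,
        Matrix.mul_smul, Matrix.mul_one,
        Matrix.smul_mul, D.transpose_mul_self, Matrix.mul_smul, Matrix.mul_vecMulVec,
        Matrix.smul_mul, Matrix.vecMulVec_mul, hUu]
    have h21 : (D.Uᵀ * Acl * D.U).toBlocks₂₁ = 0 := by
      rw [hconj]
      ext i j
      have := congrFun (congrFun D.block₂₁ i) j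
      simp only [Matrix.toBlocks₂₁, Matrix.of_apply] at this ⊢
      simp [this, Matrix.vecMulVec_apply]
    have h11 : (D.Uᵀ * Acl * D.U).toBlocks₁₁ = (D.Uᵀ * G.Ar ε * D.U).toBlocks₁₁ - ε • 1 := by
      rw [hconj]
      ext i j
      simp [Matrix.toBlocks₁₁, Matrix.vecMulVec_apply, Matrix.one_apply]
    have h22 : (D.Uᵀ * Acl * D.U).toBlocks₂₂ 0 0 = -(ε + δ) := by
      have h1 : Sum.elim (0 : Fin p → ℝ) (1 : Fin 1 → ℝ) ᵥ* (D.Uᵀ * Acl * D.U) =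
          -((ε + δ) • Sum.elim (0 : Fin p → ℝ) (1 : Fin 1 → ℝ)) := by
        rw [← Matrix.vecMul_vecMul, ← Matrix.vecMul_vecMul]
        change (u ᵥ* Acl) ᵥ* D.U = _
        rw [huc, Matrix.neg_vecMul, Matrix.smul_vecMul, hUu]
      have h2 := congrFun h1 (Sum.inr 0)
      simpa [Matrix.vecMul, dotProduct, Matrix.toBlocks₂₂] using h2
    rw [← mem_eigenvalueMultiset,
      eigenvalueMultiset_eq_add D.transpose_mul_self D.mul_transpose_self h21, Multiset.mem_add,
      mem_eigenvalueMultiset, mem_eigenvalueMultiset, h11] at hs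
    rcases hs with hs | hs
    · have := D.block₁₁ _ (eigenvalues_sub_smul_one hs)
      simp at this
      linarith
    · obtain ⟨v, hv0, hv⟩ := mem_spectrum_iff_exists_vecMul.1 hs
      have hv1 : v 0 ≠ 0 := fun h0 => hv0 (by ext i; fin_cases i; exact h0)
      have h3 := congrFun hv 0
      simp only [Matrix.vecMul, dotProduct, Fintype.sum_unique, Fin.default_eq_zero,
        Matrix.map_apply, h22, Pi.smul_apply, smul_eq_mul, mul_comm s] at h3
      have h4 := congrArg Complex.re (mul_left_cancel₀ hv1 h3)
      simp at h4
      linarith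

end Plant

/-! ### Existence of an ordered Schur decomposition -/

/-- A matrix with exactly one eigenvalue in the open right half plane, which is real, has an ordered
Schur decomposition with an anti-stable block of size one. -/
theorem exists_orderedSchur {n : ℕ} {M : Matrix (Fin n) (Fin n) ℝ} {u : Fin n → ℝ} {a : ℝ}
    (hu : u ≠ 0) (ha : 0 < a) (h : u ᵥ* M = a • u)
    (hcount : (eigenvalueMultiset M).countP (fun s => 0 < s.re) = 1) :
    ∃ p, Nonempty (OrderedSchur M p 1) := by
  obtain ⟨p, rfl⟩ : ∃ p, n = p + 1 := by
    rcases n with _ | p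
    · exact absurd (Subsingleton.elim u 0) hu
    · exact ⟨p, rfl⟩
  let e : EuclideanSpace ℝ (Fin (p + 1)) := WithLp.toLp 2 u
  have he : e ≠ 0 := fun h0 => hu (congrArg WithLp.ofLp h0)
  have hcard : Module.finrank ℝ (EuclideanSpace ℝ (Fin (p + 1))) =
      Fintype.card (Fin p ⊕ Fin 1) := by simp
  -- The normalised left eigenvector is prescribed as the last basis vector, which makes the last
  -- row of `Uᵀ M U` equal to `(0, a)`.
  have hon : Orthonormal ℝ (Set.domRestrict {(Sum.inr 0 : Fin p ⊕ Fin 1)}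
      fun _ => (‖e‖⁻¹ : ℝ) • e) := by
    rw [orthonormal_iff_ite]
    rintro ⟨i, rfl⟩ ⟨j, rfl⟩
    rw [if_pos rfl]
    simp only [Set.domRestrict_apply]
    rw [real_inner_self_eq_norm_sq, norm_smul, norm_inv, norm_norm,
      inv_mul_cancel₀ (norm_ne_zero_iff.2 he), one_pow]
  obtain ⟨b, hb⟩ := hon.exists_orthonormalBasis_extension_of_card_eq hcard
  have hbu : ∀ i, b (Sum.inr 0) i = ‖e‖⁻¹ * u i := by
    intro i
    rw [hb _ rfl]
    rfl
  let U : Matrix (Fin (p + 1)) (Fin p ⊕ Fin 1) ℝ := Matrix.of fun i j => b j i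
  have hU1 : Uᵀ * U = 1 := by
    ext i j
    have := orthonormal_iff_ite.1 b.orthonormal i j
    rw [PiLp.inner_apply] at this
    simp only [Matrix.mul_apply, Matrix.one_apply, Matrix.transpose_apply, U, Matrix.of_apply]
    rw [← this]
    refine Finset.sum_congr rfl fun k _ => ?_
    simp [mul_comm]
  have hU2 : U * Uᵀ = 1 :=
    (Matrix.mul_eq_one_comm_of_equiv (Fintype.equivOfCardEq (by simp))).1 hU1
  have hrow : ∀ j, (Uᵀ * M * U) (Sum.inr 0) j =
      a * (1 : Matrix (Fin p ⊕ Fin 1) _ ℝ) (Sum.inr 0) j := by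
    intro j
    have h1 : Uᵀ (Sum.inr 0) = ‖e‖⁻¹ • u := by
      ext i
      exact hbu i
    have h2 : (Uᵀ * M * U) (Sum.inr 0) j = ((Uᵀ (Sum.inr 0) ᵥ* M) ᵥ* U) j := rfl
    have h3 : Uᵀ (Sum.inr 0) ᵥ* M = a • Uᵀ (Sum.inr 0) := by
      rw [h1, Matrix.smul_vecMul, h, smul_comm]
    have h4 : (Uᵀ (Sum.inr 0) ᵥ* U) j = (Uᵀ * U) (Sum.inr 0) j := rfl
    rw [h2, h3, Matrix.smul_vecMul, Pi.smul_apply, h4, hU1, smul_eq_mul]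
  have h21 : (Uᵀ * M * U).toBlocks₂₁ = 0 := by
    ext i j
    fin_cases i
    simpa [Matrix.toBlocks₂₁] using hrow (Sum.inl j)
  have h22 : (Uᵀ * M * U).toBlocks₂₂ 0 0 = a := by
    simpa [Matrix.toBlocks₂₂] using hrow (Sum.inr 0)
  have hblock : ∀ s ∈ eigenvalues (Uᵀ * M * U).toBlocks₂₂, s = a := by
    intro s hs
    obtain ⟨v, hv0, hv⟩ := mem_spectrum_iff_exists_vecMul.1 hs
    have hv1 : v 0 ≠ 0 := fun h0 => hv0 (by ext i; fin_cases i; exact h0)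
    have h3 := congrFun hv 0
    rw [vecMul_finOne, Matrix.map_apply, h22, Pi.smul_apply, smul_eq_mul, mul_comm s] at h3
    exact (mul_left_cancel₀ hv1 h3).symm
  have h2 : (eigenvalueMultiset (Uᵀ * M * U).toBlocks₂₂).countP (fun s => 0 < s.re) = 1 := by
    rw [Multiset.countP_eq_card.2, card_eigenvalueMultiset, Fintype.card_fin]
    intro s hs
    rw [hblock s (mem_eigenvalueMultiset.1 hs), Complex.ofReal_re]
    exact ha
  have h1 : (eigenvalueMultiset (Uᵀ * M * U).toBlocks₁₁).countP (fun s => 0 < s.re) = 0 := by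
    rw [eigenvalueMultiset_eq_add hU1 hU2 h21, Multiset.countP_add, h2] at hcount
    omega
  refine ⟨p, ⟨⟨U, hU1, hU2, h21, fun s hs => ?_, fun s hs => ?_⟩⟩⟩
  · exact not_lt.1 (Multiset.countP_eq_zero.1 h1 s (mem_eigenvalueMultiset.2 hs))
  · rw [hblock s hs, Complex.ofReal_re]
    exact ha

/-! ### Carrying the sign of the gap from `ε₀` to `ε` -/

namespace Plant

variable {n : ℕ} (G : Plant n 1)

/-- A positive eigenvalue `l` of `A_q` yields, for every `ε ≥ 0`, a left eigenvector of `A_r(ε)` at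
`l + ε`, and the sign of its gap does not depend on `ε`. -/
theorem exists_leftEigenvector_Ar (h : IsUnit (G.C₁ * G.B₂)) {l : ℝ} (hl : 0 < l)
    (hspec : (l : ℂ) ∈ eigenvalues G.Aq) :
    ∃ g : ℝ, ∀ ε : ℝ, 0 ≤ ε → ∃ u : Fin n → ℝ, u ≠ 0 ∧ u ᵥ* G.Ar ε = (l + ε) • u ∧
      G.gap u = l / (l + ε) * g := by
  obtain ⟨v, hv0, hv⟩ := mem_spectrum_iff_exists_vecMul.1 (ofReal_mem_eigenvalues.1 hspec)
  refine ⟨G.gap v, fun ε hε => ?_⟩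
  have hne : l + ε ≠ 0 := by positivity
  refine ⟨_, ?_, vecMul_shift (G.outVec_vecMul_Q h) (G.vecMul_Q v) hv hne, G.gap_shift h hne⟩
  intro h0
  have hvc := sub_eq_zero.1 h0
  apply hv0
  have h2 : l • v = 0 := by
    rw [← hv, hvc, Matrix.smul_vecMul, Aq, ← Matrix.vecMul_vecMul, G.outVec_vecMul_Q h,
      Matrix.zero_vecMul, smul_zero]
  exact (smul_eq_zero.1 h2).resolve_left hl.ne'

/-- The lifted space is a line, so `u` is a multiple of the last column of `U`, and the gap is
quadratic. -/
theorem gap_lift_one_pos {ε : ℝ} {p : ℕ} (D : OrderedSchur (G.Ar ε) p 1) {u : Fin n → ℝ} {a : ℝ}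
    (hu : u ≠ 0) (ha : 0 < a) (hua : u ᵥ* G.Ar ε = a • u) (hg : 0 < G.gap u) :
    0 < G.gap (D.lift 1) := by
  obtain ⟨w, -, rfl, -⟩ := D.exists_eq_lift hu ha hua
  have : D.lift w = w 0 • D.lift 1 := by
    ext i
    simp [OrderedSchur.lift, Matrix.vecMul, dotProduct]
  rw [this, gap_smul] at hg
  exact pos_of_mul_pos_right hg (sq_nonneg _)

end Plant

end NISynthesis

end

theorem theorem3 {n : ℕ} (hn : 2 ≤ n) (G : NISynthesis.Plant n 1)
    -- the hypotheses of the synthesis theorem: `C₁ B₂` non-singular, `R > 0`, and solvability of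
    -- the Lyapunov conditions at one value of the parameter (`0` is allowed)
    (hA1 : IsUnit (G.C₁ * G.B₂)) (hA2 : G.R.PosDef)
    (hcond : ∃ ε₀ : ℝ, 0 ≤ ε₀ ∧ G.SynthesisConditions ε₀)
    (hctrl : NISynthesis.IsControllable G.A G.B₂)
    -- the eigenvalues of `A_q`: distinct, ordered by real part; the first `n - 2` are stable,
    -- the next one is zero, and the last one is real and positive
    (lam : Fin n → ℂ) (hinj : Function.Injective lam)
    (hspec : NISynthesis.eigenvalues G.Aq = Set.range lam)
    (hmono : Monotone fun i => (lam i).re)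
    (hstable : ∀ i : Fin n, (i : ℕ) < n - 2 → (lam i).re < 0)
    (hzero : lam ⟨n - 2, by omega⟩ = 0)
    (hpos : 0 < (lam ⟨n - 1, by omega⟩).re ∧ (lam ⟨n - 1, by omega⟩).im = 0)
    -- `0 < ε < γ`, where `γ` is minus the real part of the last stable eigenvalue
    -- (`γ = ∞` if `n = 2`, when there is none)
    (ε : ℝ) (hε : 0 < ε) (hγ : ∀ h : 3 ≤ n, ε < -(lam ⟨n - 3, by omega⟩).re) :
    G.SynthesisConditions ε ∧
    ∀ (p q : ℕ) (D : NISynthesis.OrderedSchur (G.Ar ε) p q),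
      (∃ T S : Matrix (Fin q) (Fin q) ℝ, G.LyapunovConditions D T S) ∧
      ∀ T S : Matrix (Fin q) (Fin q) ℝ, G.LyapunovConditions D T S →
        NISynthesis.IsSNIWithDegree (G.A + G.B₂ * G.K D T S) G.B₁ G.C₁ ε := by
  have hmem : ∀ i, lam i ∈ NISynthesis.eigenvalues G.Aq := fun i => hspec ▸ Set.mem_range_self i
  have hR : 0 < G.R 0 0 := hA2.diag_pos
  have hother : ∀ i : Fin n, i ≠ ⟨n - 2, by omega⟩ → i ≠ ⟨n - 1, by omega⟩ →
      (lam i).re < -ε := by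
    intro i h1 h2
    have hi := i.isLt
    have h1' : (i : ℕ) ≠ n - 2 := fun h => h1 (Fin.ext h)
    have h2' : (i : ℕ) ≠ n - 1 := fun h => h2 (Fin.ext h)
    -- An index other than the last two exists only if `3 ≤ n`, so the truncated `n - 3` is genuine
    -- here.
    have hle : i ≤ ⟨n - 3, by omega⟩ := by
      rw [Fin.le_def]
      dsimp only
      omega
    have h3 := hmono hle
    have h4 := hγ (by omega)
    dsimp only at h3
    linarith
  have hcount := G.countP_eigenvalueMultiset_Ar hA1 hinj hmem hε hzero hpos.1 hother
  have hlast : (((lam ⟨n - 1, by omega⟩).re : ℝ) : ℂ) ∈ NISynthesis.eigenvalues G.Aq := by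
    rw [show (((lam ⟨n - 1, by omega⟩).re : ℝ) : ℂ) = lam ⟨n - 1, by omega⟩ from
      Complex.ext rfl hpos.2.symm]
    exact hmem _
  obtain ⟨g, hg⟩ := G.exists_leftEigenvector_Ar hA1 hpos.1 hlast
  set l := (lam ⟨n - 1, by omega⟩).re
  have hl : 0 < l := hpos.1
  -- The same `g` governs `ε₀` and `ε`, up to the positive factors `l / (l + ε₀)` and `l / (l + ε)`.
  have hg0 : 0 < g := by
    obtain ⟨ε₀, hε₀, p, q, D, T, S, hL⟩ := hcond
    obtain ⟨u, hu0, hu, hgap⟩ := hg ε₀ hε₀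
    have := G.gap_pos_of_lyapunovConditions hR D hL hu0 (by positivity) hu
    rw [hgap] at this
    exact pos_of_mul_pos_right this (by positivity)
  obtain ⟨u, hu0, hu, hgap⟩ := hg ε hε.le
  have hgu : 0 < G.gap u := by rw [hgap]; positivity
  have hle : 0 < l + ε := by positivity
  refine ⟨?_, fun p q D => ?_⟩
  · obtain ⟨p, ⟨D⟩⟩ := NISynthesis.exists_orderedSchur hu0 hle hu hcount
    obtain ⟨T, S, hL⟩ := G.exists_lyapunovConditions hR D (G.gap_lift_one_pos D hu0 hle hu hgu)
    exact ⟨p, 1, D, T, S, hL⟩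
  · obtain rfl : q = 1 := D.countP_eigenvalueMultiset.symm.trans hcount
    exact ⟨G.exists_lyapunovConditions hR D (G.gap_lift_one_pos D hu0 hle hu hgu),
      fun T S hL => G.isSNIWithDegree_closedLoop hA1 hR hε D hL⟩
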